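/- **Model.** Consider the following symbolic model (labelled multiset rewriting over a term algebra with an equational theory, in the style of the Tamarin prover) of the oblivious digital token (ODT) protocol, with an unbounded number of participants and sessions. *Messages* are built from public constants and fresh names by pairing, a hash $H$, public keys $\mathsf{pk}(sk)$, signatures $\mathsf{sign}(m,sk)$, the TLS Diffie–Hellman group $g_{DH}^{e}$ (exponents $e$ are products of names and their inverses, $(g_{DH}^{a})^{b}=g_{DH}^{ab}$), the key derivation $\mathsf{HKDF}$, the position selector $\mathsf{Select}(k)$, the values $\mathsf{read}(S,M)$ found at the positions $S$ in a process with properties $M$, mirrored memories with $\mathsf{read}(S,\mathsf{mirror}(S,x))=x$, and the messages of an idealized equality test: $y=g^{t}$, the commitment $v=g^{s}u^{w}$ to a witness $w$, and the response $z=v^{t}u^{-wt}$, with the equation $z=y^{s}$ if the committed and the responding $u$ and $w$ agree. A witness is $H(b,x)$, where $x$ are the values read and the flag $b$ records whether the O-TEE was interrupted while reading; $\mathsf{Measure}(S,M)=H(\text{not interrupted},\mathsf{read}(S,M))$. *Roles.* (1) A neutral party $NP$, never compromised, generates and publishes its key, instantiates O-TEEs (each bound to a device $D$, with a fresh signing key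 $sk$) and certifies their public keys; event $\mathsf{OTEERegisteredOnDevice}(NP,\textit{O-TEE},D)$. (2) An aggressor $AGR$ creates agents $AGT$ with fresh properties $prop$; event $\mathsf{AggressorCreateAgent}(AGR,AGT,prop)$. (3) Agents and other processes run on devices, an agent possibly on several. (4) An O-TEE on $D$, triggered by a process $P$ on $D$, sends $(u,g_{DH}^{x})$ with fresh $u,x$. On receiving $(v,Y)$ it derives $DHE=Y^{x}$ (event $\mathsf{OTEEDHKey}(\textit{O-TEE},DHE)$) and $k=\mathsf{HKDF}(DHE)$, measures $w=\mathsf{Measure}(\mathsf{Select}(k),M)$ where $M$ are the current properties of $P$ (event $\mathsf{OTEEHonestPropertyRead}(\textit{O-TEE},D,P,M)$), and sends $(y,z,\sigma)$ with $y=g^{t}$, $z=v^{t}u^{-wt}$, $t$ fresh, $\sigma=\mathsf{sign}((y,z,H(k)),sk)$. Afterwards it passes $k$ to its device. (5) An aggressor, as a TLS server that expects its agent $AGT$ with properties $prop$, receives $(u,X)$, derives $DHE=X^{y_s}$ with fresh $y_s$ (event $\mathsf{AggrDHKey}(AGR,DHE)$), $k=\mathsf{HKDF}(DHE)$ and $w'=\mathsf{Measure}(\mathsf{Select}(k),prop)$,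 and sends $(g^{s}u^{w'},g_{DH}^{y_s})$ with fresh $s$; in place of the received $u$ it may also use a random one. On receiving $(y,z,\sigma)$ and a certificate it accepts, with event $\mathsf{AcceptedVerificationWithAgent}(AGR,\textit{O-TEE},AGT,prop)$, if the certificate of $\textit{O-TEE}$'s public key was issued by a neutral party, $\sigma$ is valid under that key for $(y,z,H(k))$, and $z=y^{s}$. *Adversary.* It controls the network (all messages are sent to it, and messages are received from it), applies all the operations above to what it knows, generates names, and can compromise any device. On a compromised device it runs processes whose properties are any message it knows; reads the values of any process at positions that it knows (but never all properties of a process at once); interrupts a measurement, thereby learning $\mathsf{Select}(k)$, and then chooses the values that the O-TEE reads, in which case the flag in the witness is set to "interrupted" and no honest-read event occurs; and learns $k$ once the O-TEE has sent $(y,z,\sigma)$. **Binding integrity.** For every trace of this system, all $AGR$, $\textit{O-TEE}$, $AGT$, $prop$ and every time point $i$: if $\mathsf{AcceptedVerificationWithAgent}(AGR,\textit{O-TEE},AGT,prop)$ occurs at $i$, then there are $NP$, $D$, $DHE$ and time points $j,k,l,m,n$ of the trace such that - $\mathsf{OTEERegisteredOnDevice}(NP,\textit{O-TEE},D)$ occurs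 at $j$, - $\mathsf{OTEEHonestPropertyRead}(\textit{O-TEE},D,AGT,prop)$ occurs at $k$, - $\mathsf{AggressorCreateAgent}(AGR,AGT,prop)$ occurs at $l$, - $\mathsf{AggrDHKey}(AGR,DHE)$ occurs at $m$, and - $\mathsf{OTEEDHKey}(\textit{O-TEE},DHE)$ occurs at $n$. That is, the accepted O-TEE is a genuine one registered on a device $D$ by a neutral party, it honestly measured the agent on $D$ with the properties $prop$, the aggressor created that agent with these properties, and the aggressor and the O-TEE derived the same Diffie–Hellman secret. -/

import Mathlib

/-! Symbolic (Dolev-Yao) model of the oblivious digital token (ODT) protocol: a term algebra with its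
equational theory, and a labelled multiset rewriting system for the five protocol roles and the
adversary. -/

namespace ODT

/-- Public identities (of neutral parties, devices, O-TEEs and aggressors). -/
abbrev Ident := ℕ

/-- Freshly generated, unguessable values (keys, exponents, nonces, process properties). -/
abbrev Name := ℕ

/-- Exponents of the Diffie-Hellman theory: the free abelian group on the names, i.e. formal products
`∏ n ^ (e n)` of names and their inverses; the product of exponents is written additively. -/
abbrev Expo := Name →₀ ℤ

/-- A name used as an exponent. -/
noncomputable def sc (n : Name) : Expo := Finsupp.single n 1

/-- Messages, in normal form with respect to the equational theory.  The equations
`(g ^ a) ^ b = g ^ (a * b)` and the abelian group laws of exponents are built into the representation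
of group elements by their exponent; the equations for reading memory and for the equality test
are built into the operations `read` and `respond` below.  Everything else is a free symbol, i.e. an
idealized cryptographic operator. -/
inductive Msg : Type
  /-- public constant -/
  | pub (c : ℕ)
  /-- fresh name -/
  | fresh (n : Name)
  /-- exponent -/
  | scalar (e : Expo)
  | pair (a b : Msg)
  | hash (m : Msg)
  /-- public key of a private key -/
  | pk (sk : Msg)
  /-- signature on `m` with `sk` -/
  | sign (m sk : Msg)
  /-- element `g_DH ^ e` of the TLS Diffie-Hellman group -/
  | dh (e : Expo)
  /-- the key derivation function HKDF of TLS -/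
  | kdf (m : Msg)
  /-- the set of positions `Select(k)` -/
  | select (k : Msg)
  /-- the values found at the positions `S` in a process with properties (memory) `M` -/
  | readAt (S M : Msg)
  /-- a process memory made to hold the values `vals` at the positions `S` -/
  | mirror (S vals : Msg)
  /-- element `g ^ e` of the group of the equality test -/
  | gel (e : Expo)
  /-- the verifier's commitment `g ^ s * u ^ w` to the witness `w` -/
  | commit (u w : Msg) (s : Expo)
  /-- the prover's answer `v ^ t * u ^ (- w * t)`, when it does not simplify -/
  | resp (v u w : Msg) (t : Expo)

open Msg

open Classical in
/-- Reading the positions `S` of a memory `M`, with the equation `read S (mirror S vals) = vals`. -/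
noncomputable def read (S : Msg) : Msg → Msg
  | mirror S' vals => if S' = S then vals else readAt S (mirror S' vals)
  | M => readAt S M

open Classical in
/-- The prover's third message `z = v ^ t * u ^ (- w * t)` in the equality test, with the equation
`respond (g ^ s * u ^ w) u w t = g ^ (s * t)`, i.e. `z = y ^ s` for `y = g ^ t`. -/
noncomputable def respond (v u w : Msg) (t : Expo) : Msg :=
  match v with
  | commit u' w' s => if u' = u ∧ w' = w then gel (s + t) else resp (commit u' w' s) u w t
  | v => resp v u w t

/-- The witness: the hash of the co-residence flag and of the values that were read.  The flag is
`true` if the O-TEE was not interrupted while it was reading. -/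
def witness (coResident : Bool) (vals : Msg) : Msg :=
  hash (pair (pub (if coResident then 0 else 1)) vals)

/-- `Measure(S, M)`: the witness of an uninterrupted measurement. -/
noncomputable def measure (S M : Msg) : Msg := witness true (read S M)

/-- `σ` is a valid signature on `m` for the public key `pkey`. -/
def Verifies (pkey m σ : Msg) : Prop := ∃ sk, pkey = pk sk ∧ σ = sign m sk

/-- What an O-TEE signs: the two group elements `y`, `z` and the hash of the key. -/
def signedPart (y z k : Msg) : Msg := pair y (pair z (hash k))

/-- The token `(y, z, σ)` that an O-TEE with signing key `sk` sends after a handshake with key `k`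
and nonces `u` (its own) and `v` (the server's), for the witness `w` and the randomness `t`. -/
noncomputable def token (sk : Name) (k u v w : Msg) (t : Name) : Msg :=
  pair (gel (sc t)) (pair (respond v u w (sc t))
    (sign (signedPart (gel (sc t)) (respond v u w (sc t)) k) (fresh sk)))

/-- What a neutral party signs to certify that `pkO` is the public key of the O-TEE `O`. -/
def certBody (O : Ident) (pkO : Msg) : Msg := pair (pub O) pkO

/-- Facts of the rewriting system. -/
inductive Fact : Type
  /-- `n` was generated and is not used yet -/
  | fr (n : Name)
  /-- the adversary knows `m`; the adversary is the network, so an honest party sends `m` by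
  producing this fact and can receive `m` whenever this fact holds -/
  | know (m : Msg)
  | neutral (NP : Ident) (sk : Name)
  | neutralPk (NP : Ident) (pkNP : Msg)
  | device (D : Ident)
  | compromised (D : Ident)
  /-- a genuine O-TEE on the device `D` with its signing key -/
  | otee (O D : Ident) (sk : Name)
  | aggressor (A : Ident)
  /-- the aggressor `A` created the agent `P` with properties `prop` -/
  | agent (A : Ident) (P prop : Msg)
  /-- the process `P` runs on the device `D` and exhibits the properties `M` -/
  | process (D : Ident) (P M : Msg)
  /-- O-TEE session for `P` that sent its ClientHello with nonce `u` and key share `g_DH ^ x` -/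
  | oteeHello (O D : Ident) (sk : Name) (P : Msg) (x u : Name)
  /-- O-TEE session that derived the handshake secret `HS` and has not measured yet -/
  | oteeReady (O D : Ident) (sk : Name) (P : Msg) (u : Name) (HS v : Msg)
  /-- O-TEE session that was interrupted while measuring -/
  | oteeInterrupted (O D : Ident) (sk : Name) (P : Msg) (u : Name) (HS v : Msg)
  /-- O-TEE session that sent its token -/
  | oteeDone (D : Ident) (k : Msg)
  /-- aggressor session for the agent `P` that awaits a token -/
  | aggrWait (A : Ident) (P prop HS : Msg) (s : Name)

/-- Linear facts are consumed by the rules that use them, all other facts are persistent. -/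
def Fact.linear : Fact → Bool
  | .fr _ => true
  | .oteeHello .. => true
  | .oteeReady .. => true
  | .oteeInterrupted .. => true
  | .oteeDone .. => true
  | .aggrWait .. => true
  | _ => false

/-- Events that label the transitions. -/
inductive Event : Type
  | OTEERegisteredOnDevice (NP O D : Ident)
  | AggressorCreateAgent (A : Ident) (P prop : Msg)
  | DeviceCompromised (D : Ident)
  | OTEEDHKey (O : Ident) (DHE : Msg)
  | OTEEHonestPropertyRead (O D : Ident) (P prop : Msg)
  | OTEEInterrupted (O D : Ident)
  | AggrDHKey (A : Ident) (DHE : Msg)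
  | AcceptedVerificationWithAgent (A O : Ident) (P prop : Msg)

open _root_.ODT.Fact _root_.ODT.Event

/-- Message deduction: the adversary generates names, knows all public constants and generators, and
applies all function symbols and their inverses where these exist. -/
inductive AdvRule : List Fact → List Fact → Prop
  | new (n : Name) : AdvRule [fr n] [know (fresh n)]
  | pub (c : ℕ) : AdvRule [] [know (pub c)]
  | pair (a b : Msg) : AdvRule [know a, know b] [know (pair a b)]
  | fst (a b : Msg) : AdvRule [know (pair a b)] [know a]
  | snd (a b : Msg) : AdvRule [know (pair a b)] [know b]
  | hash (m : Msg) : AdvRule [know m] [know (hash m)]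
  | pk (sk : Msg) : AdvRule [know sk] [know (pk sk)]
  | sign (m sk : Msg) : AdvRule [know m, know sk] [know (sign m sk)]
  | kdf (m : Msg) : AdvRule [know m] [know (kdf m)]
  | select (k : Msg) : AdvRule [know k] [know (select k)]
  | read (S M : Msg) : AdvRule [know S, know M] [know (read S M)]
  | mirror (S vals : Msg) : AdvRule [know S, know vals] [know (mirror S vals)]
  | scalar (n : Name) : AdvRule [know (fresh n)] [know (scalar (sc n))]
  | one : AdvRule [] [know (scalar 0)]
  | mul (e f : Expo) : AdvRule [know (scalar e), know (scalar f)] [know (scalar (e + f))]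
  | inv (e : Expo) : AdvRule [know (scalar e)] [know (scalar (-e))]
  | dhGen : AdvRule [] [know (dh 0)]
  | dhExp (e f : Expo) : AdvRule [know (dh e), know (scalar f)] [know (dh (e + f))]
  | gGen : AdvRule [] [know (gel 0)]
  | gExp (e f : Expo) : AdvRule [know (gel e), know (scalar f)] [know (gel (e + f))]
  | commit (u w : Msg) (s : Expo) :
      AdvRule [know u, know w, know (scalar s)] [know (commit u w s)]
  | respond (v u w : Msg) (t : Expo) :
      AdvRule [know v, know u, know w, know (scalar t)] [know (respond v u w t)]

/-- The rules of the protocol roles and of compromised devices (premises, events, conclusions). -/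
inductive ProtoRule : List Fact → List Event → List Fact → Prop
  /-- A neutral party generates and publishes its key.  Neutral parties are never compromised. -/
  | createNeutral (NP : Ident) (sk : Name) :
      ProtoRule [fr sk] [] [neutral NP sk, neutralPk NP (pk (fresh sk)), know (pk (fresh sk))]
  | createDevice (D : Ident) : ProtoRule [] [] [device D]
  | createAggressor (A : Ident) : ProtoRule [] [] [aggressor A]
  /-- A neutral party instantiates an O-TEE bound to a device and certifies its public key. -/
  | registerOTEE (NP O D : Ident) (skNP sk : Name) :
      ProtoRule [neutral NP skNP, device D, fr sk] [OTEERegisteredOnDevice NP O D]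
        [otee O D sk, know (pk (fresh sk)), know (sign (certBody O (pk (fresh sk))) (fresh skNP))]
  /-- An aggressor creates an agent; its properties identify it, and the adversary does not know
  all of them. -/
  | createAgent (A : Ident) (P prop : Name) :
      ProtoRule [aggressor A, fr P, fr prop] [AggressorCreateAgent A (fresh P) (fresh prop)]
        [agent A (fresh P) (fresh prop), know (fresh P)]
  /-- An agent runs on a device (any number of times, on any devices). -/
  | runAgent (A D : Ident) (P prop : Msg) :
      ProtoRule [agent A P prop, device D] [] [process D P prop]
  /-- Some other honest process runs on a device. -/
  | runOther (D : Ident) (P M : Name) :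
      ProtoRule [device D, fr P, fr M] [] [process D (fresh P) (fresh M), know (fresh P)]
  | compromise (D : Ident) : ProtoRule [device D] [DeviceCompromised D] [compromised D]
  /-- On a compromised device the adversary runs processes, under any identity it likes, with
  any properties it can produce, and may change the properties of its processes later. -/
  | runAdversarial (D : Ident) (P M : Msg) :
      ProtoRule [compromised D, know P, know M] [] [process D P M]
  /-- On a compromised device the adversary copies parts of the memory of running processes, at
  positions that it knows, but not whole processes. -/
  | readMemory (D : Ident) (P M S : Msg) :
      ProtoRule [compromised D, process D P M, know S] [] [know (read S M)]
  /-- Triggered by a process, an O-TEE sends ClientHello: a random group element `u` as nonce and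
  the key share `g_DH ^ x`. -/
  | oteeClientHello (O D : Ident) (sk : Name) (P M : Msg) (x u : Name) :
      ProtoRule [otee O D sk, process D P M, fr x, fr u] []
        [oteeHello O D sk P x u, know (pair (fresh u) (dh (sc x)))]
  /-- The O-TEE receives ServerHello: a nonce `v` and a key share `Y = g_DH ^ e`; it derives the
  handshake secret `Y ^ x`. -/
  | oteeServerHello (O D : Ident) (sk : Name) (P : Msg) (x u : Name) (v : Msg) (e : Expo) :
      ProtoRule [oteeHello O D sk P x u, know (pair v (dh e))] [OTEEDHKey O (dh (e + sc x))]
        [oteeReady O D sk P u (dh (e + sc x)) v]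
  /-- The O-TEE measures the process without being interrupted (in one atomic step, at positions
  that it has not disclosed) and sends its token. -/
  | oteeMeasure (O D : Ident) (sk : Name) (P M : Msg) (u : Name) (HS v : Msg) (t : Name) :
      ProtoRule [oteeReady O D sk P u HS v, process D P M, fr t] [OTEEHonestPropertyRead O D P M]
        [oteeDone D (kdf HS),
          know (token sk (kdf HS) (fresh u) v (measure (select (kdf HS)) M) t)]
  /-- On a compromised device the adversary interrupts the measurement and learns the positions. -/
  | interrupt (O D : Ident) (sk : Name) (P : Msg) (u : Name) (HS v : Msg) :
      ProtoRule [oteeReady O D sk P u HS v, compromised D] [OTEEInterrupted O D]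
        [oteeInterrupted O D sk P u HS v, know (select (kdf HS))]
  /-- The O-TEE is resumed; the adversary chooses the values it reads, and the flag in the witness
  records the interrupt. -/
  | resume (O D : Ident) (sk : Name) (P : Msg) (u : Name) (HS v vals : Msg) (t : Name) :
      ProtoRule [oteeInterrupted O D sk P u HS v, know vals, fr t] []
        [oteeDone D (kdf HS), know (token sk (kdf HS) (fresh u) v (witness false vals) t)]
  /-- After sending the token, the O-TEE passes the session key to its device. -/
  | passKey (D : Ident) (k : Msg) : ProtoRule [oteeDone D k, compromised D] [] [know k]
  /-- The aggressor, as a TLS server that expects the agent `P`, receives ClientHello with nonce `u`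
  and key share `X = g_DH ^ e`.  It derives the handshake secret `X ^ y` and answers with its
  commitment to the expected witness as nonce and its key share `g_DH ^ y`. -/
  | aggrServerHello (A : Ident) (P prop u : Msg) (e : Expo) (y s : Name) :
      ProtoRule [agent A P prop, know (pair u (dh e)), fr y, fr s] [AggrDHKey A (dh (e + sc y))]
        [aggrWait A P prop (dh (e + sc y)) s,
          know (pair (commit u (measure (select (kdf (dh (e + sc y)))) prop) (sc s)) (dh (sc y)))]
  /-- The same, for a nonce that is not a group element: the aggressor uses a random `u'`. -/
  | aggrServerHello' (A : Ident) (P prop u : Msg) (e : Expo) (y s u' : Name) :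
      ProtoRule [agent A P prop, know (pair u (dh e)), fr y, fr s, fr u']
        [AggrDHKey A (dh (e + sc y))]
        [aggrWait A P prop (dh (e + sc y)) s,
          know (pair (commit (fresh u') (measure (select (kdf (dh (e + sc y)))) prop) (sc s))
            (dh (sc y)))]
  /-- The aggressor receives a token `(y, z, σ)` with `y = g ^ e`, and a certificate.  It accepts if
  the certificate was issued by a neutral party, `σ` is valid for the certified O-TEE key,
  and `z = y ^ s`. -/
  | aggrVerify (A NP O : Ident) (P prop HS : Msg) (s : Name) (pkNP pkO c σ : Msg) (e : Expo)
      (hcert : Verifies pkNP (certBody O pkO) c)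
      (hsig : Verifies pkO (signedPart (gel e) (gel (e + sc s)) (kdf HS)) σ) :
      ProtoRule [aggrWait A P prop HS s, neutralPk NP pkNP, know (pair pkO c),
          know (pair (gel e) (pair (gel (e + sc s)) σ))]
        [AcceptedVerificationWithAgent A O P prop] []

/-- A configuration: the multiset of current facts and the names generated so far. -/
structure Config where
  facts : Multiset Fact
  used : Finset Name

/-- The linear facts of a list of premises. -/
def linearPart (l : List Fact) : Multiset Fact := (l.filter Fact.linear : List Fact)

/-- Labelled transitions: fresh name generation, message deduction, protocol rules.  The linear
premises of a rule are consumed, its persistent premises have to be present. -/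
inductive Step : Config → List Event → Config → Prop
  | new (S : Multiset Fact) (used : Finset Name) (n : Name) (hn : n ∉ used) :
      Step ⟨S, used⟩ [] ⟨fr n ::ₘ S, insert n used⟩
  | adv (S : Multiset Fact) (used : Finset Name) (l r : List Fact) (h : AdvRule l r)
      (hp : ∀ f ∈ l, f.linear = false → f ∈ S) :
      Step ⟨linearPart l + S, used⟩ [] ⟨(r : Multiset Fact) + S, used⟩
  | proto (S : Multiset Fact) (used : Finset Name) (l : List Fact) (a : List Event)
      (r : List Fact) (h : ProtoRule l a r) (hp : ∀ f ∈ l, f.linear = false → f ∈ S) :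
      Step ⟨linearPart l + S, used⟩ a ⟨(r : Multiset Fact) + S, used⟩

/-- Executions from the empty configuration, with the sequence of their labels. -/
inductive Exec : List (List Event) → Config → Prop
  | init : Exec [] ⟨0, ∅⟩
  | step (tr : List (List Event)) (c c' : Config) (a : List Event) :
      Exec tr c → Step c a c' → Exec (tr ++ [a]) c'

/-- The traces of the ODT protocol. -/
def IsTrace (tr : List (List Event)) : Prop := ∃ c, Exec tr c

/-- The event `ev` occurs in the trace `tr` at the time point `i`. -/
def OccursAt (tr : List (List Event)) (ev : Event) (i : ℕ) : Prop :=
  ∃ a, tr[i]? = some a ∧ ev ∈ a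

end ODT

/-!
The theorem is a safety property, proved by an inductive invariant over executions.

The invariant speaks about a *ghost state* that is not part of the system: the purpose for which
each generated name was consumed (`Role`), the set of O-TEE sessions that have measured or were
interrupted (recorded by their nonces), and the events so far.  Relative to it, `Knowable` is an
over-approximation of what the adversary knows, defined by recursion on messages.  It is deliberately
coarse (hashes, public keys, group elements of the equality test, and values read are always
knowable) and is precise about five things:

* names and scalars: only names with role `disclosed` are knowable, hence no signing key, no secret
  exponent, and no properties of agents;
* Diffie–Hellman elements: up to known exponents, at most one secret key share occurs in them
  (`DHKnown`), so the secret shared by an O-TEE and an aggressor, which contains two, is not knowable;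
* session keys: beyond the keys of knowable secrets, only those of spent O-TEE sessions are knowable;
* signatures: under an undisclosed key only certificates of registered O-TEEs and tokens of O-TEEs;
* commitments: with an undisclosed exponent `s`, only the one sent by the aggressor who chose `s`.

All of these are monotone in the ghost state, which only grows.

The decisive step is an uninterrupted measurement (`honest_read_of_witness_eq`): if it yields the
witness that an aggressor with the same handshake secret has committed to, then the process measured
is the aggressor's agent.  The only other way to show these values is a memory of the form
`mirror S vals`, where `S` are the positions selected by the session key.  The adversary had to know
`S` to build it, but the exponent of the handshake secret consists of the two key shares and known
names, so a knowable `S` can only stem from the O-TEE session with this very key share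
(`not_knowable_key_of_shared`), and that session has disclosed nothing before it measures.

On acceptance, the certificate and the signature come from a registered O-TEE, the signed
hash of the key identifies the handshake secret, and `z = y ^ s` forces the O-TEE to have answered
the aggressor's own commitment.  The flag in the witness excludes an interrupted measurement.
-/

namespace ODT

open Msg _root_.ODT.Fact Event

/-! ### Ghost state -/

/-- The purpose for which a generated name has been consumed. -/
inductive Role : Type
  /-- sent in clear or generated by the adversary -/
  | disclosed
  | neutralKey
  | oteeKey (O D : Ident)
  /-- exponent of the key share of the O-TEE session with nonce `u` -/
  | oteeShare (u : Name)
  /-- exponent of the key share of an aggressor -/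
  | aggrShare
  /-- exponent of the commitment that `A` made for its agent `P` with properties `prop` in a handshake
  with secret `HS` -/
  | aggrCommit (A : Ident) (P prop HS : Msg)
  /-- properties of the agent `P` of `A` -/
  | agentProp (A : Ident) (P : Msg)
  /-- properties of an honest process that is not an agent -/
  | otherProp

/-- History information added to a configuration.  A name without a role is either not consumed yet
or was consumed for a purpose that is irrelevant to the proof. -/
structure Ghost where
  role : Name → Option Role
  /-- nonces of the O-TEE sessions that have measured or were interrupted -/
  spent : Set Name
  events : Set Event

/-- The order in which ghost states evolve. -/
structure Ghost.Le (g g' : Ghost) : Prop where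
  role : ∀ n ρ, g.role n = some ρ → g'.role n = some ρ
  spent : g.spent ⊆ g'.spent
  events : g.events ⊆ g'.events

/-! ### Over-approximation of the adversary's knowledge -/

/-- `e` is a product of powers of disclosed names. -/
def DisclosedExpo (g : Ghost) (e : Expo) : Prop := ∀ n, e n ≠ 0 → g.role n = some .disclosed

/-- `n` is the exponent of a key share of an honest party. -/
def IsShare (g : Ghost) (n : Name) : Prop :=
  g.role n = some .aggrShare ∨ ∃ u, g.role n = some (.oteeShare u)

/-- The adversary may know `g_DH ^ e`: up to disclosed names, the exponent is trivial or a single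
key share. -/
def DHKnown (g : Ghost) (e : Expo) : Prop :=
  ∃ a, DisclosedExpo g a ∧ (e = a ∨ ∃ n, IsShare g n ∧ e = a + sc n)

/-- `HS` is the handshake secret of a spent O-TEE session. -/
def SpentSecret (g : Ghost) (HS : Msg) : Prop :=
  ∃ u ∈ g.spent, ∃ x e, g.role x = some (.oteeShare u) ∧ DHKnown g e ∧ HS = dh (e + sc x)

/-- What a token that an O-TEE signed with the key `sk` guarantees. If `z` is a power of the
generator, then the O-TEE answered a commitment with exponent `f`, which was made either by the
adversary or by an aggressor; in the latter case, if the aggressor has the same handshake secret,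
the O-TEE has honestly measured the aggressor's agent. -/
def GenuineToken (g : Ghost) (sk : Name) (m : Msg) : Prop :=
  ∃ O D t HS z, g.role sk = some (.oteeKey O D) ∧ m = signedPart (gel (sc t)) z (kdf HS) ∧
    OTEEDHKey O HS ∈ g.events ∧
    ∀ e, z = gel e → ∃ f, e = f + sc t ∧ (DisclosedExpo g f ∨
      ∃ s A P prop HS', f = sc s ∧ g.role s = some (.aggrCommit A P prop HS') ∧
        (HS' = HS → OTEEHonestPropertyRead O D P prop ∈ g.events))

/-- `m` is the body of a certificate of a registered O-TEE. -/
def GenuineCert (g : Ghost) (m : Msg) : Prop :=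
  ∃ NP O D sk, g.role sk = some (.oteeKey O D) ∧ m = certBody O (pk (fresh sk)) ∧
    OTEERegisteredOnDevice NP O D ∈ g.events

/-- `HS` is a handshake secret that an aggressor derived. -/
def AggrSecret (g : Ghost) (HS : Msg) : Prop :=
  ∃ y e, g.role y = some .aggrShare ∧ DHKnown g e ∧ HS = dh (e + sc y)

/-- `prop` are the properties of the agent `P` of `A`. -/
def AgentOf (g : Ghost) (A : Ident) (P prop : Msg) : Prop :=
  ∃ p, prop = fresh p ∧ g.role p = some (.agentProp A P)

/-- The commitment with exponent `e` to the witness `w` was made by an aggressor. -/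
def AggrCommitment (g : Ghost) (w : Msg) (e : Expo) : Prop :=
  ∃ s A P prop HS, e = sc s ∧ g.role s = some (.aggrCommit A P prop HS) ∧
    w = measure (select (kdf HS)) prop ∧ AgentOf g A P prop ∧ AggrSecret g HS

/-- A superset of the messages that the adversary knows. -/
def Knowable (g : Ghost) : Msg → Prop
  | fresh n => g.role n = some .disclosed
  | scalar e => DisclosedExpo g e
  | pair a b => Knowable g a ∧ Knowable g b
  | sign m sk => Knowable g sk ∨ ∃ n, sk = fresh n ∧
      ((g.role n = some .neutralKey ∧ GenuineCert g m) ∨ GenuineToken g n m)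
  | dh e => DHKnown g e
  | kdf m => Knowable g m ∨ SpentSecret g m
  | select k => Knowable g k
  | mirror S vals => Knowable g S ∧ Knowable g vals
  | commit _ w s => DisclosedExpo g s ∨ AggrCommitment g w s
  | _ => True

section Monotonicity

variable {g g' : Ghost} (h : g.Le g')
include h

theorem DisclosedExpo.mono {e : Expo} (he : DisclosedExpo g e) : DisclosedExpo g' e :=
  fun n hn => h.role _ _ (he n hn)

theorem DHKnown.mono {e : Expo} : DHKnown g e → DHKnown g' e := by
  rintro ⟨a, ha, h1⟩
  refine ⟨a, ha.mono h, h1.imp_right ?_⟩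
  rintro ⟨n, hn, rfl⟩
  exact ⟨n, hn.imp (h.role _ _) (fun ⟨u, hu⟩ => ⟨u, h.role _ _ hu⟩), rfl⟩

theorem SpentSecret.mono {m : Msg} : SpentSecret g m → SpentSecret g' m := by
  rintro ⟨u, hu, x, e, hx, he, rfl⟩
  exact ⟨u, h.spent hu, x, e, h.role _ _ hx, he.mono h, rfl⟩

theorem GenuineToken.mono {sk : Name} {m : Msg} : GenuineToken g sk m → GenuineToken g' sk m := by
  rintro ⟨O, D, t, HS, z, h1, h2, h3, h4⟩
  refine ⟨O, D, t, HS, z, h.role _ _ h1, h2, h.events h3, fun e he => ?_⟩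
  obtain ⟨f, hf, h5⟩ := h4 e he
  refine ⟨f, hf, h5.imp (fun hd => hd.mono h) ?_⟩
  rintro ⟨s, A, P, prop, HS', h6, h7, h8⟩
  exact ⟨s, A, P, prop, HS', h6, h.role _ _ h7, fun hh => h.events (h8 hh)⟩

theorem GenuineCert.mono {m : Msg} : GenuineCert g m → GenuineCert g' m := by
  rintro ⟨NP, O, D, sk, h1, h2, h3⟩
  exact ⟨NP, O, D, sk, h.role _ _ h1, h2, h.events h3⟩

theorem AggrSecret.mono {m : Msg} : AggrSecret g m → AggrSecret g' m := by
  rintro ⟨y, e, h1, h2, h3⟩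
  exact ⟨y, e, h.role _ _ h1, h2.mono h, h3⟩

theorem AgentOf.mono {A : Ident} {P prop : Msg} : AgentOf g A P prop → AgentOf g' A P prop := by
  rintro ⟨p, h1, h2⟩
  exact ⟨p, h1, h.role _ _ h2⟩

theorem AggrCommitment.mono {w : Msg} {e : Expo} :
    AggrCommitment g w e → AggrCommitment g' w e := by
  rintro ⟨s, A, P, prop, HS, h1, h2, h3, h4, h5⟩
  exact ⟨s, A, P, prop, HS, h1, h.role _ _ h2, h3, h4.mono h, h5.mono h⟩

theorem Knowable.mono {m : Msg} (hm : Knowable g m) : Knowable g' m := by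
  induction m with
  | fresh n => exact h.role _ _ hm
  | scalar e => exact DisclosedExpo.mono h hm
  | pair a b iha ihb => exact ⟨iha hm.1, ihb hm.2⟩
  | sign m sk _ ih =>
    refine Or.imp ih ?_ hm
    rintro ⟨n, rfl, h1⟩
    exact ⟨n, rfl, h1.imp (fun h2 => ⟨h.role _ _ h2.1, h2.2.mono h⟩) fun h2 => h2.mono h⟩
  | dh e => exact DHKnown.mono h hm
  | kdf m ih => exact Or.imp ih (SpentSecret.mono h) hm
  | select k ih => exact ih hm
  | mirror S vals ih1 ih2 => exact ⟨ih1 hm.1, ih2 hm.2⟩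
  | commit u w s => exact Or.imp (DisclosedExpo.mono h) (AggrCommitment.mono h) hm
  | _ => trivial

end Monotonicity

/-! ### Exponents -/

theorem sc_same (n : Name) : sc n n = 1 := Finsupp.single_eq_same

theorem sc_ne {m n : Name} (h : m ≠ n) : sc m n = 0 := by
  simp [sc, h]

theorem sc_injective : Function.Injective sc := Finsupp.single_left_injective one_ne_zero

theorem disclosedExpo_zero (g : Ghost) : DisclosedExpo g 0 := fun _ hn => absurd rfl hn

theorem DisclosedExpo.add {g : Ghost} {e f : Expo} (he : DisclosedExpo g e)
    (hf : DisclosedExpo g f) : DisclosedExpo g (e + f) := by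
  intro n hn
  by_cases h : e n = 0
  · exact hf n fun h' => hn (by simp [h, h'])
  · exact he n h

theorem DisclosedExpo.neg {g : Ghost} {e : Expo} (he : DisclosedExpo g e) :
    DisclosedExpo g (-e) := fun n hn => he n fun h => hn (by simp [h])

theorem disclosedExpo_sc {g : Ghost} {n : Name} :
    DisclosedExpo g (sc n) ↔ g.role n = some .disclosed := by
  constructor
  · exact fun h => h n (by simp [sc_same])
  · intro h m hm
    by_cases hnm : n = m
    · exact hnm ▸ h
    · exact absurd (sc_ne hnm) hm

theorem DisclosedExpo.dhKnown {g : Ghost} {e : Expo} (he : DisclosedExpo g e) : DHKnown g e :=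
  ⟨e, he, .inl rfl⟩

theorem IsShare.dhKnown {g : Ghost} {n : Name} (h : IsShare g n) : DHKnown g (sc n) :=
  ⟨0, disclosedExpo_zero g, .inr ⟨n, h, by simp⟩⟩

theorem IsShare.not_disclosed {g : Ghost} {n : Name} (h : IsShare g n) :
    g.role n ≠ some .disclosed := by
  rcases h with h | ⟨u, h⟩ <;> simp [h]

theorem DHKnown.add {g : Ghost} {e f : Expo} (he : DHKnown g e) (hf : DisclosedExpo g f) :
    DHKnown g (e + f) := by
  obtain ⟨a, ha, rfl | ⟨n, hn, rfl⟩⟩ := he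
  · exact (ha.add hf).dhKnown
  · exact ⟨a + f, ha.add hf, .inr ⟨n, hn, add_right_comm _ _ _⟩⟩

theorem DHKnown.nonneg {g : Ghost} {e : Expo} (he : DHKnown g e) {n : Name}
    (hn : g.role n ≠ some .disclosed) : 0 ≤ e n := by
  obtain ⟨a, ha, h⟩ := he
  have han : a n = 0 := not_not.1 fun h => hn (ha n h)
  obtain rfl | ⟨m, hm, rfl⟩ := h
  · exact han.ge
  · by_cases hmn : m = n
    · subst hmn; simp [han, sc_same]
    · simp [han, sc_ne hmn]

theorem DHKnown.eq_of_pos {g : Ghost} {e : Expo} (he : DHKnown g e) {m n : Name}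
    (hm : g.role m ≠ some .disclosed) (hn : g.role n ≠ some .disclosed)
    (hm' : 0 < e m) (hn' : 0 < e n) : m = n := by
  obtain ⟨a, ha, h⟩ := he
  have ham : a m = 0 := not_not.1 fun h => hm (ha m h)
  have han : a n = 0 := not_not.1 fun h => hn (ha n h)
  obtain rfl | ⟨k, hk, rfl⟩ := h
  · omega
  · have h1 : k = m := by
      by_contra hne
      simp [ham, sc_ne hne] at hm'
    have h2 : k = n := by
      by_contra hne
      simp [han, sc_ne hne] at hn'
    exact h1.symm.trans h2

/-- The session key of a handshake between an O-TEE session that is not spent and an aggressor is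
not knowable. -/
theorem not_knowable_key_of_shared {g : Ghost} {HS : Msg} {u x : Name} {e : Expo}
    (hu : u ∉ g.spent) (hx : g.role x = some (.oteeShare u)) (he : DHKnown g e)
    (hHS : HS = dh (e + sc x)) (hA : AggrSecret g HS) : ¬ Knowable g (kdf HS) := by
  subst hHS
  obtain ⟨y, e', hy, he', heq⟩ := hA
  have heq : e + sc x = e' + sc y := by simpa using heq
  have hxy : x ≠ y := by rintro rfl; simp [hx] at hy
  have hxd : g.role x ≠ some .disclosed := by simp [hx]
  have hyd : g.role y ≠ some .disclosed := by simp [hy]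
  have hey : 0 < e y := by
    have h := DFunLike.congr_fun heq y
    have := he'.nonneg hyd
    simp [sc_same, sc_ne hxy] at h
    omega
  rintro (hk | ⟨u', hu', x', e'', hx', he'', heq'⟩)
  · refine hxy (DHKnown.eq_of_pos hk hxd hyd ?_ ?_)
    · have := he.nonneg hxd
      simp [sc_same]; omega
    · simp [sc_ne hxy]; exact hey
  · have heq' : e + sc x = e'' + sc x' := by simpa using heq'
    by_cases hxx : x = x'
    · subst hxx
      obtain rfl : u = u' := by simpa [hx] using hx'
      exact hu hu'
    · -- otherwise `e` would contain the two key shares `x'` and `y`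
      have hxd' : g.role x' ≠ some .disclosed := by simp [hx']
      have hex : 0 < e x' := by
        have h := DFunLike.congr_fun heq' x'
        have := he''.nonneg hxd'
        simp [sc_same, sc_ne hxx] at h
        omega
      obtain rfl := he.eq_of_pos hxd' hyd hex hey
      simp [hx'] at hy

/-! ### Operations on memories and the equality test -/

theorem Knowable.read {g : Ghost} {S M : Msg} (hM : Knowable g M) : Knowable g (read S M) := by
  cases M with
  | mirror S' vals =>
    simp only [ODT.read]
    split_ifs
    · exact hM.2
    · trivial
  | _ => trivial

theorem eq_fresh_or_mirror_of_read_eq {S M : Msg} {n : Name}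
    (h : read S M = readAt S (fresh n)) : M = fresh n ∨ ∃ vals, M = mirror S vals := by
  cases M with
  | mirror S' vals =>
    simp only [read] at h
    split_ifs at h with hS
    · exact .inr ⟨vals, by rw [hS]⟩
    · simp at h
  | _ => simp_all [read]

theorem knowable_respond (g : Ghost) (v u w : Msg) (t : Expo) : Knowable g (respond v u w t) := by
  cases v with
  | commit =>
    simp only [respond]
    split_ifs <;> trivial
  | _ => trivial

theorem eq_commit_of_respond_eq_gel {v u w : Msg} {t e : Expo} (h : respond v u w t = gel e) :
    ∃ f, v = commit u w f ∧ e = f + t := by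
  cases v with
  | commit u' w' s =>
    simp only [respond] at h
    split_ifs at h with hc
    exact ⟨s, by rw [hc.1, hc.2], by simpa using h.symm⟩
  | _ => simp [respond] at h

theorem witness_injective {b b' : Bool} {m m' : Msg} (h : witness b m = witness b' m') :
    b = b' ∧ m = m' := by
  cases b <;> cases b' <;> simp_all [witness]

/-- A signature of an O-TEE under its own key is a genuine token, provided that the witness in it
matches an aggressor's commitment only after an honest measurement. -/
theorem knowable_token {g : Ghost} {O D : Ident} {sk t : Name} {HS u v w : Msg}
    (hsk : g.role sk = some (.oteeKey O D)) (hev : OTEEDHKey O HS ∈ g.events)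
    (hv : Knowable g v)
    (hw : ∀ A P prop, AgentOf g A P prop → AggrSecret g HS →
      w = measure (select (kdf HS)) prop → OTEEHonestPropertyRead O D P prop ∈ g.events) :
    Knowable g (token sk (kdf HS) u v w t) := by
  refine ⟨trivial, knowable_respond _ _ _ _ _, .inr ⟨sk, rfl, .inr ?_⟩⟩
  refine ⟨O, D, t, HS, _, hsk, rfl, hev, fun e he => ?_⟩
  obtain ⟨f, rfl, hf⟩ := eq_commit_of_respond_eq_gel he
  refine ⟨f, hf, Or.imp_right ?_ hv⟩
  rintro ⟨s, A, P, prop, HS', hs, hr, hm, hag, hsec⟩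
  refine ⟨s, A, P, prop, HS', hs, hr, ?_⟩
  rintro rfl
  exact hw A P prop hag hsec hm

/-! ### The invariant -/

/-- What the invariant says about a process with properties `M`. -/
def ProcessOK (g : Ghost) (P M : Msg) : Prop :=
  Knowable g M ∨ (∃ A, AgentOf g A P M) ∨ ∃ n, M = fresh n ∧ g.role n = some .otherProp

/-- What the invariant says about a single fact. -/
def FactOK (g : Ghost) : Fact → Prop
  | know m => Knowable g m
  | neutral _ sk => g.role sk = some .neutralKey
  | neutralPk _ pkNP => ∃ sk, pkNP = pk (fresh sk) ∧ g.role sk = some .neutralKey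
  | otee O D sk => g.role sk = some (.oteeKey O D)
  | agent A P prop => AgentOf g A P prop ∧ AggressorCreateAgent A P prop ∈ g.events
  | process _ P M => ProcessOK g P M
  | oteeHello O D sk _ x u => g.role sk = some (.oteeKey O D) ∧ g.role x = some (.oteeShare u)
  | oteeReady O D sk _ u HS v => g.role sk = some (.oteeKey O D) ∧ Knowable g v ∧
      OTEEDHKey O HS ∈ g.events ∧
      ∃ x e, g.role x = some (.oteeShare u) ∧ DHKnown g e ∧ HS = dh (e + sc x)
  | oteeInterrupted O D sk _ _ HS v => g.role sk = some (.oteeKey O D) ∧ Knowable g v ∧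
      OTEEDHKey O HS ∈ g.events ∧ SpentSecret g HS
  | oteeDone _ k => Knowable g k
  | aggrWait A P prop HS s => g.role s = some (.aggrCommit A P prop HS) ∧
      AggressorCreateAgent A P prop ∈ g.events ∧ AggrDHKey A HS ∈ g.events
  | _ => True

theorem FactOK.mono {g g' : Ghost} (h : g.Le g') {f : Fact} (hf : FactOK g f) : FactOK g' f := by
  cases f with
  | know m => exact Knowable.mono h hf
  | neutral NP sk => exact h.role _ _ hf
  | neutralPk NP pkNP => exact hf.imp fun sk hk => ⟨hk.1, h.role _ _ hk.2⟩
  | otee O D sk => exact h.role _ _ hf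
  | agent A P prop => exact ⟨hf.1.mono h, h.events hf.2⟩
  | process D P M =>
    exact Or.imp (Knowable.mono h) (Or.imp (Exists.imp fun A => AgentOf.mono h)
      (Exists.imp fun n => And.imp_right (h.role _ _))) hf
  | oteeHello O D sk P x u => exact ⟨h.role _ _ hf.1, h.role _ _ hf.2⟩
  | oteeReady O D sk P u HS v =>
    obtain ⟨h1, h2, h3, x, e, h4, h5, h6⟩ := hf
    exact ⟨h.role _ _ h1, h2.mono h, h.events h3, x, e, h.role _ _ h4, h5.mono h, h6⟩
  | oteeInterrupted O D sk P u HS v =>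
    exact ⟨h.role _ _ hf.1, hf.2.1.mono h, h.events hf.2.2.1, hf.2.2.2.mono h⟩
  | oteeDone D k => exact Knowable.mono h hf
  | aggrWait A P prop HS s => exact ⟨h.role _ _ hf.1, h.events hf.2.1, h.events hf.2.2⟩
  | _ => trivial

/-- The name that a linear fact owns: an unused fresh name, or the nonce of an O-TEE session that has
not measured yet.  No name is owned twice. -/
def owned : Fact → Option Name
  | fr n => some n
  | oteeHello _ _ _ _ _ u => some u
  | oteeReady _ _ _ _ u _ _ => some u
  | _ => none

/-- The names owned by the facts of a configuration. -/
def ownedNames (S : Multiset Fact) : Multiset Name := S.filterMap owned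

theorem ownedNames_add (S T : Multiset Fact) :
    ownedNames (S + T) = ownedNames S + ownedNames T := Multiset.filterMap_add _ _ _

theorem mem_ownedNames {S : Multiset Fact} {f : Fact} {n : Name} (hf : f ∈ S)
    (hn : owned f = some n) : n ∈ ownedNames S := (Multiset.mem_filterMap _ _).2 ⟨f, hf, hn⟩

theorem ownedNames_coe (l : List Fact) :
    ownedNames (l : Multiset Fact) = (l.filterMap owned : List Name) := rfl

theorem ownedNames_linearPart (l : List Fact) :
    ownedNames (linearPart l) = (l.filterMap owned : List Name) := by
  induction l with
  | nil => rfl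
  | cons f l ih =>
    simp only [linearPart, ownedNames_coe, Multiset.coe_eq_coe] at ih ⊢
    cases f <;> simpa [List.filter_cons, List.filterMap_cons, Fact.linear, owned] using ih

/-- The invariant of executions. -/
structure Inv (g : Ghost) (c : Config) : Prop where
  nodup : (ownedNames c.facts).Nodup
  owned_used : ∀ n ∈ ownedNames c.facts, n ∈ c.used
  role_used : ∀ n, g.role n ≠ none → n ∈ c.used
  spent_used : ∀ n ∈ g.spent, n ∈ c.used
  fr_role : ∀ n, fr n ∈ c.facts → g.role n = none
  spent_owned : ∀ n ∈ g.spent, n ∉ ownedNames c.facts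
  facts_ok : ∀ f ∈ c.facts, FactOK g f

theorem mem_of_mem_premises {S : Multiset Fact} {l : List Fact}
    (hp : ∀ f ∈ l, f.linear = false → f ∈ S) {f : Fact} (hf : f ∈ l) : f ∈ linearPart l + S := by
  cases h : f.linear with
  | false => exact Multiset.mem_add.2 (.inr (hp f hf h))
  | true => exact Multiset.mem_add.2 (.inl (by simp [linearPart, hf, h]))

/-- A rule preserves the invariant if it assigns roles only to names that it consumes, marks as
spent only names that it stops owning, and produces correct facts. -/
theorem Inv.apply_rule {g g' : Ghost} {S : Multiset Fact} {used : Finset Name} {l r : List Fact}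
    (hinv : Inv g ⟨linearPart l + S, used⟩)
    (hnofr : ∀ n, fr n ∉ r)
    (howned : (r.filterMap owned).Sublist (l.filterMap owned))
    (hrole : ∀ n, g'.role n = g.role n ∨ fr n ∈ l)
    (hspent : ∀ u ∈ g'.spent, u ∈ g.spent ∨
      (u ∈ l.filterMap owned ∧ u ∉ r.filterMap owned))
    (hle : g.Le g')
    (hfacts : ∀ f ∈ r, FactOK g' f) : Inv g' ⟨(r : Multiset Fact) + S, used⟩ := by
  obtain ⟨nodup, owned_used, role_used, spent_used, fr_role, spent_owned, facts_ok⟩ := hinv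
  simp only [ownedNames_add, ownedNames_linearPart] at nodup owned_used spent_owned
  have hfrl : ∀ n, fr n ∈ l → n ∈ (l.filterMap owned : Multiset Name) := fun n hn =>
    Multiset.mem_coe.2 (List.mem_filterMap.2 ⟨fr n, hn, rfl⟩)
  have hdisj := (Multiset.nodup_add.1 nodup).2.2
  have hsub : ownedNames r + ownedNames S ≤ (l.filterMap owned : Multiset Name) + ownedNames S :=
    add_le_add_left (Multiset.coe_le.2 howned.subperm) _
  refine ⟨?_, ?_, ?_, ?_, ?_, ?_, ?_⟩
  · simpa only [ownedNames_add] using Multiset.nodup_of_le hsub nodup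
  · intro n hn
    simp only [ownedNames_add] at hn
    exact owned_used n (Multiset.mem_of_le hsub hn)
  · intro n hn
    rcases hrole n with h | h
    · exact role_used n (h ▸ hn)
    · exact owned_used n (Multiset.mem_add.2 (.inl (hfrl n h)))
  · intro n hn
    rcases hspent n hn with h | h
    · exact spent_used n h
    · exact owned_used n (Multiset.mem_add.2 (.inl h.1))
  · intro n hn
    have hnS : fr n ∈ S := by simpa [hnofr] using hn
    rcases hrole n with h | h
    · exact h ▸ fr_role n (Multiset.mem_add.2 (.inr hnS))
    · exact absurd (mem_ownedNames hnS rfl) (Multiset.disjoint_left.1 hdisj (hfrl n h))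
  · intro n hn hn'
    simp only [ownedNames_add] at hn'
    rcases hspent n hn with h | h
    · exact spent_owned n h (Multiset.mem_of_le hsub hn')
    · rcases Multiset.mem_add.1 hn' with h' | h'
      · exact h.2 h'
      · exact Multiset.disjoint_left.1 hdisj h.1 h'
  · intro f hf
    rcases Multiset.mem_add.1 hf with hf | hf
    · exact hfacts f (by simpa using hf)
    · exact (facts_ok f (Multiset.mem_add.2 (.inr hf))).mono hle

/-- The ghost state after the roles `ρ` were assigned, the sessions `sp` were spent and the events
`a` occurred. -/
def Ghost.extend (g : Ghost) (ρ : Name → Option Role) (sp : Set Name) (a : List Event) : Ghost :=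
  ⟨ρ, g.spent ∪ sp, g.events ∪ {ev | ev ∈ a}⟩

theorem Ghost.le_extend {g : Ghost} {S : Multiset Fact} {used : Finset Name} {l : List Fact}
    (hinv : Inv g ⟨linearPart l + S, used⟩) {ρ : Name → Option Role}
    (hrole : ∀ n, ρ n = g.role n ∨ fr n ∈ l) (sp : Set Name) (a : List Event) :
    g.Le (g.extend ρ sp a) where
  role n r hn := by
    rcases hrole n with h | h
    · exact h.trans hn
    · have := hinv.fr_role n
        (Multiset.mem_add.2 (.inl (by simp [linearPart, h, Fact.linear])))
      simp [this] at hn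
  spent := Set.subset_union_left
  events := Set.subset_union_left

theorem mem_extend_events {g : Ghost} {ρ : Name → Option Role} {sp : Set Name} {a : List Event}
    {ev : Event} (h : ev ∈ a) : ev ∈ (g.extend ρ sp a).events := .inr h

/-- `Inv.apply_rule` for an extension of the ghost state.  The bookkeeping obligations are discharged
by default for concrete lists of premises and conclusions. -/
theorem Inv.extend {g : Ghost} {S : Multiset Fact} {used : Finset Name} {l r : List Fact}
    (hinv : Inv g ⟨linearPart l + S, used⟩)
    (ρ : Name → Option Role) (sp : Set Name) (a : List Event)
    (hrole : ∀ n, ρ n = g.role n ∨ fr n ∈ l)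
    (hfacts : g.Le (g.extend ρ sp a) → ∀ f ∈ r, FactOK (g.extend ρ sp a) f)
    (hnofr : ∀ n, fr n ∉ r := by simp)
    (howned : (r.filterMap owned).Sublist (l.filterMap owned) := by
      simp [List.filterMap_cons, owned])
    (hspent : ∀ u ∈ sp, u ∈ l.filterMap owned ∧ u ∉ r.filterMap owned := by
      simp [List.filterMap_cons, owned]) :
    Inv (g.extend ρ sp a) ⟨(r : Multiset Fact) + S, used⟩ :=
  hinv.apply_rule hnofr howned hrole (fun u hu => hu.imp_right (hspent u))
    (Ghost.le_extend hinv hrole sp a) (hfacts (Ghost.le_extend hinv hrole sp a))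

/-! ### Preservation by the rules -/

theorem Inv.new {g : Ghost} {S : Multiset Fact} {used : Finset Name} {n : Name}
    (hinv : Inv g ⟨S, used⟩) (hn : n ∉ used) : Inv g ⟨fr n ::ₘ S, insert n used⟩ := by
  obtain ⟨nodup, owned_used, role_used, spent_used, fr_role, spent_owned, facts_ok⟩ := hinv
  have hcons : ownedNames (fr n ::ₘ S) = n ::ₘ ownedNames S :=
    Multiset.filterMap_cons_some _ _ _ rfl
  refine ⟨?_, ?_, ?_, ?_, ?_, ?_, ?_⟩
  · rw [hcons]
    exact Multiset.nodup_cons.2 ⟨fun h => hn (owned_used n h), nodup⟩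
  · rw [hcons]
    intro m hm
    rcases Multiset.mem_cons.1 hm with rfl | hm
    · exact Finset.mem_insert_self _ _
    · exact Finset.mem_insert_of_mem (owned_used m hm)
  · exact fun m hm => Finset.mem_insert_of_mem (role_used m hm)
  · exact fun m hm => Finset.mem_insert_of_mem (spent_used m hm)
  · intro m hm
    rcases Multiset.mem_cons.1 hm with h | hm
    · obtain rfl : m = n := by simpa using h
      exact not_not.1 fun h => hn (role_used m h)
    · exact fr_role m hm
  · rw [hcons]
    intro m hm hm'
    rcases Multiset.mem_cons.1 hm' with rfl | hm'
    · exact hn (spent_used m hm)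
    · exact spent_owned m hm hm'
  · intro f hf
    rcases Multiset.mem_cons.1 hf with rfl | hf
    · trivial
    · exact facts_ok f hf

/-- Message deduction stays within the knowable messages. -/
theorem AdvRule.conclusions_ok {l r : List Fact} (h : AdvRule l r) {g : Ghost}
    (hl : ∀ f ∈ l, FactOK g f) (hfr : ∀ n, fr n ∈ l → g.role n = some .disclosed) :
    ∀ f ∈ r, FactOK g f := by
  cases h <;> simp only [forall_eq, List.mem_cons, List.not_mem_nil, or_false,
    forall_eq_or_imp, FactOK] at hl hfr ⊢
  case new n => exact hfr n rfl
  case pair => exact hl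
  case fst => exact hl.1
  case snd => exact hl.2
  case sign => exact .inl hl.2
  case kdf => exact .inl hl
  case select => exact hl
  case read => exact hl.2.read
  case mirror => exact hl
  case scalar => exact disclosedExpo_sc.2 hl
  case one => exact disclosedExpo_zero g
  case mul => exact DisclosedExpo.add hl.1 hl.2
  case inv => exact DisclosedExpo.neg hl
  case dhGen => exact (disclosedExpo_zero g).dhKnown
  case dhExp => exact DHKnown.add hl.1 hl.2
  case commit => exact .inl hl.2.2
  case respond => exact knowable_respond _ _ _ _ _
  all_goals trivial

open Classical in
theorem Inv.adv {g : Ghost} {S : Multiset Fact} {used : Finset Name} {l r : List Fact}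
    (hinv : Inv g ⟨linearPart l + S, used⟩) (h : AdvRule l r)
    (hp : ∀ f ∈ l, f.linear = false → f ∈ S) :
    ∃ ρ, Inv (g.extend ρ ∅ []) ⟨(r : Multiset Fact) + S, used⟩ := by
  refine ⟨fun n => if fr n ∈ l then some .disclosed else g.role n,
    hinv.extend _ _ _ (fun n => ?_) (fun hle => ?_) (fun n => ?_) ?_⟩
  · by_cases hn : fr n ∈ l <;> simp [hn]
  · exact h.conclusions_ok (fun f hf => (hinv.facts_ok f (mem_of_mem_premises hp hf)).mono hle)
      (fun n hn => by simp [Ghost.extend, hn])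
  · cases h <;> simp
  · cases h <;> simp [List.filterMap_cons, owned]

/-- An uninterrupted measurement that yields the witness expected by an aggressor with the same
handshake secret is a measurement of the aggressor's agent. -/
theorem honest_read_of_witness_eq {g : Ghost} {A : Ident} {HS P P' M prop : Msg} {u x : Name}
    {e : Expo} (hu : u ∉ g.spent) (hx : g.role x = some (.oteeShare u)) (he : DHKnown g e)
    (hHS : HS = dh (e + sc x)) (hM : ProcessOK g P' M) (hag : AgentOf g A P prop)
    (hsec : AggrSecret g HS)
    (hw : measure (select (kdf HS)) M = measure (select (kdf HS)) prop) : P' = P ∧ M = prop := by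
  obtain ⟨p, rfl, hp⟩ := hag
  rcases eq_fresh_or_mirror_of_read_eq (witness_injective hw).2 with rfl | ⟨vals, rfl⟩
  · refine ⟨?_, rfl⟩
    rcases hM with hM | ⟨A', p', hpp, hp'⟩ | ⟨n, hn, hn'⟩
    · simp [Knowable, hp] at hM
    · obtain rfl : p = p' := by simpa using hpp
      rw [hp] at hp'
      simp only [Option.some.injEq, Role.agentProp.injEq] at hp'
      exact hp'.2.symm
    · obtain rfl : p = n := by simpa using hn
      simp [hp] at hn'
  · exfalso
    rcases hM with hM | ⟨A', p', hpp, -⟩ | ⟨n, hn, -⟩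
    · exact not_knowable_key_of_shared hu hx he hHS hsec hM.1
    · simp at hpp
    · simp at hn

theorem Inv.nodup_premises {g : Ghost} {S : Multiset Fact} {used : Finset Name} {l : List Fact}
    (hinv : Inv g ⟨linearPart l + S, used⟩) : (l.filterMap owned).Nodup := by
  have h := hinv.nodup
  simp only [ownedNames_add, ownedNames_linearPart] at h
  exact Multiset.coe_nodup.1 (Multiset.nodup_add.1 h).1

theorem Inv.not_spent {g : Ghost} {S : Multiset Fact} {used : Finset Name} {l : List Fact}
    (hinv : Inv g ⟨linearPart l + S, used⟩) {u : Name} (hu : u ∈ l.filterMap owned) :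
    u ∉ g.spent := fun h => hinv.spent_owned u h (by
  simp only [ownedNames_add, ownedNames_linearPart]
  exact Multiset.mem_add.2 (.inl hu))

/-- The common conclusions of the two rules for ServerHello of an aggressor, which differ in the nonce
`u` of the commitment. -/
theorem aggrServerHello_conclusions_ok {g : Ghost} {A : Ident} {P prop : Msg} {e : Expo}
    {y s : Name} (hagent : FactOK g (agent A P prop)) (he : DHKnown g e)
    (hy : g.role y = some .aggrShare)
    (hs : g.role s = some (.aggrCommit A P prop (dh (e + sc y))))
    (hev : AggrDHKey A (dh (e + sc y)) ∈ g.events) (u : Msg) :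
    ∀ f ∈ [aggrWait A P prop (dh (e + sc y)) s,
      know (Msg.pair (commit u (measure (select (kdf (dh (e + sc y)))) prop) (sc s))
        (dh (sc y)))], FactOK g f := by
  simp only [List.mem_cons, List.not_mem_nil, or_false, forall_eq_or_imp, forall_eq]
  exact ⟨⟨hs, hagent.2, hev⟩,
    .inr ⟨s, A, P, prop, _, rfl, hs, rfl, hagent.1, y, e, hy, he, rfl⟩,
    IsShare.dhKnown (.inl hy)⟩

/-- Each protocol rule preserves the invariant, for a suitable assignment of roles to the fresh names
that it consumes. -/
theorem Inv.proto {g : Ghost} {S : Multiset Fact} {used : Finset Name} {l r : List Fact}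
    {a : List Event} (hinv : Inv g ⟨linearPart l + S, used⟩) (h : ProtoRule l a r)
    (hp : ∀ f ∈ l, f.linear = false → f ∈ S) :
    ∃ ρ sp, Inv (g.extend ρ sp a) ⟨(r : Multiset Fact) + S, used⟩ := by
  have hl : ∀ f ∈ l, FactOK g f := fun f hf => hinv.facts_ok f (mem_of_mem_premises hp hf)
  have hnd := hinv.nodup_premises
  have hns := fun u => hinv.not_spent (u := u)
  -- the obligation about roles, for rules that consume one or two names
  have upd1 : ∀ (n : Name) (ρ : Role), fr n ∈ l →
      ∀ m, Function.update g.role n (some ρ) m = g.role m ∨ fr m ∈ l := by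
    intro n ρ hn m
    by_cases hm : m = n
    · exact .inr (hm ▸ hn)
    · simp [hm]
  have upd2 : ∀ (n n' : Name) (ρ ρ' : Role), fr n ∈ l → fr n' ∈ l → ∀ m,
      Function.update (Function.update g.role n (some ρ)) n' (some ρ') m = g.role m ∨
        fr m ∈ l := by
    intro n n' ρ ρ' hn hn' m
    by_cases hm : m = n'
    · exact .inr (hm ▸ hn')
    · simpa [hm] using upd1 n ρ hn m
  cases h with
  | createNeutral NP sk =>
    refine ⟨_, ∅, hinv.extend (Function.update g.role sk (some .neutralKey)) _ _
      (upd1 _ _ (by simp)) fun hle => ?_⟩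
    simp [FactOK, Ghost.extend, Knowable]
  | createDevice D =>
    exact ⟨_, ∅, hinv.extend g.role _ _ (by simp) fun hle => by simp [FactOK]⟩
  | createAggressor A =>
    exact ⟨_, ∅, hinv.extend g.role _ _ (by simp) fun hle => by simp [FactOK]⟩
  | registerOTEE NP O D skNP sk =>
    refine ⟨_, ∅, hinv.extend (Function.update g.role sk (some (.oteeKey O D))) _ _
      (upd1 _ _ (by simp)) fun hle => ?_⟩
    have hNP := hle.role _ _ (hl (neutral NP skNP) (by simp))
    simp only [List.mem_cons, List.not_mem_nil, or_false, forall_eq_or_imp, forall_eq]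
    refine ⟨by simp [FactOK, Ghost.extend], trivial, .inr ⟨skNP, rfl, .inl ⟨hNP, ?_⟩⟩⟩
    exact ⟨NP, O, D, sk, by simp [Ghost.extend], rfl, mem_extend_events (by simp)⟩
  | createAgent A P prop =>
    have hne : P ≠ prop := by simpa [List.filterMap_cons, owned] using hnd
    refine ⟨_, ∅, hinv.extend (Function.update (Function.update g.role P (some .disclosed)) prop
      (some (.agentProp A (fresh P)))) _ _
      (upd2 _ _ _ _ (by simp) (by simp)) fun hle => ?_⟩
    simp only [List.mem_cons, List.not_mem_nil, or_false, forall_eq_or_imp, forall_eq]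
    refine ⟨⟨⟨prop, rfl, by simp [Ghost.extend]⟩, mem_extend_events (by simp)⟩, ?_⟩
    simp [FactOK, Knowable, Ghost.extend, hne]
  | runAgent A D P prop =>
    refine ⟨_, ∅, hinv.extend g.role _ _ (by simp) fun hle => ?_⟩
    have h1 := (hl (agent A P prop) (by simp)).mono hle
    simp only [List.mem_singleton, forall_eq]
    exact .inr (.inl ⟨A, h1.1⟩)
  | runOther D P M =>
    have hne : P ≠ M := by simpa [List.filterMap_cons, owned] using hnd
    refine ⟨_, ∅, hinv.extend (Function.update (Function.update g.role P (some .disclosed)) M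
      (some .otherProp)) _ _
      (upd2 _ _ _ _ (by simp) (by simp)) fun hle => ?_⟩
    simp only [List.mem_cons, List.not_mem_nil, or_false, forall_eq_or_imp, forall_eq]
    refine ⟨.inr (.inr ⟨M, rfl, by simp [Ghost.extend]⟩), ?_⟩
    simp [FactOK, Knowable, Ghost.extend, hne]
  | compromise D =>
    exact ⟨_, ∅, hinv.extend g.role _ _ (by simp) fun hle => by simp [FactOK]⟩
  | runAdversarial D P M =>
    refine ⟨_, ∅, hinv.extend g.role _ _ (by simp) fun hle => ?_⟩
    simp only [List.mem_singleton, forall_eq]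
    exact .inl ((hl (know M) (by simp)).mono hle)
  | readMemory D P M S =>
    refine ⟨_, ∅, hinv.extend g.role _ _ (by simp) fun hle => ?_⟩
    simp only [List.mem_singleton, forall_eq]
    rcases (hl (process D P M) (by simp)).mono hle with h1 | ⟨_, n, rfl, -⟩ | ⟨n, rfl, -⟩
    · exact h1.read
    · trivial
    · trivial
  | oteeClientHello O D sk P M x u =>
    have hne : x ≠ u := by simpa [List.filterMap_cons, owned] using hnd
    refine ⟨_, ∅, hinv.extend (Function.update (Function.update g.role u (some .disclosed)) x
      (some (.oteeShare u))) _ _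
      (upd2 _ _ _ _ (by simp) (by simp)) fun hle => ?_⟩
    have hsk := hle.role _ _ (hl (otee O D sk) (by simp))
    simp only [List.mem_cons, List.not_mem_nil, or_false, forall_eq_or_imp, forall_eq]
    refine ⟨⟨hsk, by simp [Ghost.extend]⟩, by simp [Knowable, Ghost.extend, hne.symm], ?_⟩
    exact IsShare.dhKnown (.inr ⟨u, by simp [Ghost.extend]⟩)
  | oteeServerHello O D sk P x u v e =>
    refine ⟨_, ∅, hinv.extend g.role _ _ (by simp) fun hle => ?_⟩
    have h1 := (hl (oteeHello O D sk P x u) (by simp)).mono hle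
    have h2 := (hl (know (Msg.pair v (dh e))) (by simp)).mono hle
    simp only [List.mem_singleton, forall_eq]
    exact ⟨h1.1, h2.1, mem_extend_events (by simp), x, e, h1.2, h2.2, rfl⟩
  | oteeMeasure O D sk P M u HS v t =>
    refine ⟨_, {u}, hinv.extend g.role _ _ (by simp) fun hle => ?_⟩
    have hu : u ∉ g.spent := hns u (by simp [List.filterMap_cons, owned])
    have hM : ProcessOK g P M := hl (process D P M) (by simp)
    obtain ⟨hsk, hv, hev, x, e, hx, he, hHS⟩ := hl (oteeReady O D sk P u HS v) (by simp)
    simp only [List.mem_cons, List.not_mem_nil, or_false, forall_eq_or_imp, forall_eq]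
    refine ⟨.inr ⟨u, .inr rfl, x, e, hle.role _ _ hx, he.mono hle, hHS⟩,
      knowable_token (hle.role _ _ hsk) (hle.events hev) (hv.mono hle) ?_⟩
    -- no role has changed, so the facts about the aggressor hold for the ghost state before
    -- the measurement, when this session had not disclosed anything
    intro A P' prop hag hsec hw
    obtain ⟨rfl, rfl⟩ := honest_read_of_witness_eq hu hx he hHS hM
      (show AgentOf g A P' prop from hag) (show AggrSecret g HS from hsec) hw
    exact mem_extend_events (by simp)
  | interrupt O D sk P u HS v =>
    refine ⟨_, {u}, hinv.extend g.role _ _ (by simp) fun hle => ?_⟩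
    obtain ⟨hsk, hv, hev, x, e, hx, he, hHS⟩ :=
      (hl (oteeReady O D sk P u HS v) (by simp)).mono hle
    have hspent : SpentSecret (g.extend g.role {u} [OTEEInterrupted O D]) HS :=
      ⟨u, .inr rfl, x, e, hx, he, hHS⟩
    simp only [List.mem_cons, List.not_mem_nil, or_false, forall_eq_or_imp, forall_eq]
    exact ⟨⟨hsk, hv, hev, hspent⟩, .inr hspent⟩
  | resume O D sk P u HS v vals t =>
    refine ⟨_, ∅, hinv.extend g.role _ _ (by simp) fun hle => ?_⟩
    obtain ⟨hsk, hv, hev, hspent⟩ := (hl (oteeInterrupted O D sk P u HS v) (by simp)).mono hle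
    simp only [List.mem_cons, List.not_mem_nil, or_false, forall_eq_or_imp, forall_eq]
    refine ⟨.inr hspent, knowable_token hsk hev hv ?_⟩
    intro A P' prop _ _ hw
    -- the flag in the witness differs from that of an uninterrupted measurement
    simpa using (witness_injective hw).1
  | passKey D k =>
    refine ⟨_, ∅, hinv.extend g.role _ _ (by simp) fun hle => ?_⟩
    simp only [List.mem_singleton, forall_eq]
    exact (hl (oteeDone D k) (by simp)).mono hle
  | aggrServerHello A P prop u e y s =>
    have hne : y ≠ s := by simpa [List.filterMap_cons, owned] using hnd
    refine ⟨_, ∅, hinv.extend (Function.update (Function.update g.role y (some .aggrShare)) s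
      (some (.aggrCommit A P prop (dh (e + sc y))))) _ _
      (upd2 _ _ _ _ (by simp) (by simp)) fun hle => ?_⟩
    have h1 := (hl (agent A P prop) (by simp)).mono hle
    have h2 := (hl (know (Msg.pair u (dh e))) (by simp)).mono hle
    exact aggrServerHello_conclusions_ok h1 h2.2 (by simp [Ghost.extend, hne])
      (by simp [Ghost.extend]) (mem_extend_events (by simp)) u
  | aggrServerHello' A P prop u e y s u' =>
    have hne : y ≠ s := by
      simp only [owned, List.filterMap_cons, List.filterMap_nil, List.nodup_cons,
        List.mem_cons, not_or] at hnd
      exact hnd.1.1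
    refine ⟨_, ∅, hinv.extend (Function.update (Function.update g.role y (some .aggrShare)) s
      (some (.aggrCommit A P prop (dh (e + sc y))))) _ _
      (upd2 _ _ _ _ (by simp) (by simp)) fun hle => ?_⟩
    have h1 := (hl (agent A P prop) (by simp)).mono hle
    have h2 := (hl (know (Msg.pair u (dh e))) (by simp)).mono hle
    exact aggrServerHello_conclusions_ok h1 h2.2 (by simp [Ghost.extend, hne])
      (by simp [Ghost.extend]) (mem_extend_events (by simp)) (fresh u')
  | aggrVerify =>
    exact ⟨_, ∅, hinv.extend g.role _ _ (by simp) fun hle => by simp⟩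

/-! ### Acceptance -/

/-- The events `evs` contain those that binding integrity demands for an acceptance. -/
def AcceptJustified (evs : Set Event) (A O : Ident) (P prop : Msg) : Prop :=
  ∃ NP D DHE, OTEERegisteredOnDevice NP O D ∈ evs ∧ OTEEHonestPropertyRead O D P prop ∈ evs ∧
    AggressorCreateAgent A P prop ∈ evs ∧ AggrDHKey A DHE ∈ evs ∧ OTEEDHKey O DHE ∈ evs

theorem Inv.acceptJustified {g : Ghost} {S : Multiset Fact} {used : Finset Name}
    {l r : List Fact} {a : List Event} (hinv : Inv g ⟨linearPart l + S, used⟩)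
    (h : ProtoRule l a r) (hp : ∀ f ∈ l, f.linear = false → f ∈ S) {A O : Ident} {P prop : Msg}
    (hacc : AcceptedVerificationWithAgent A O P prop ∈ a) :
    AcceptJustified g.events A O P prop := by
  have hl : ∀ f ∈ l, FactOK g f := fun f hf => hinv.facts_ok f (mem_of_mem_premises hp hf)
  cases h <;> simp only [List.mem_singleton, List.not_mem_nil, reduceCtorEq] at hacc
  case aggrVerify A NP O P prop HS s pkNP pkO c σ e hcert hsig =>
  cases hacc
  obtain ⟨skNP', rfl, rfl⟩ := hcert
  obtain ⟨skO', rfl, rfl⟩ := hsig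
  obtain ⟨hs, hagent, hkey⟩ := hl (aggrWait A P prop HS s) (by simp)
  obtain ⟨skNP, hpk, hskNP⟩ := hl (neutralPk NP (pk skNP')) (by simp)
  obtain rfl : skNP' = fresh skNP := by simpa using hpk
  have hc := (hl (know _) (List.mem_cons_of_mem _ (List.mem_cons_of_mem _ List.mem_cons_self))).2
  have hσ := (hl (know (Msg.pair (gel e) (Msg.pair (gel (e + sc s)) _)))
    (by simp only [List.mem_cons]; exact .inr (.inr (.inr (.inl rfl))))).2.2
  -- the certificate is genuine, since the key of the neutral party is not disclosed
  rcases hc with hc | ⟨n, hn, hc⟩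
  · simp [Knowable, hskNP] at hc
  obtain rfl : skNP = n := by simpa using hn
  rcases hc with ⟨-, NP', O', D, sk, hsk, hbody, hreg⟩ | ⟨O', D, t, HS', z, hsk, -⟩
  swap
  · simp [hskNP] at hsk
  simp only [certBody, Msg.pair.injEq, Msg.pub.injEq, Msg.pk.injEq] at hbody
  obtain ⟨rfl, rfl⟩ := hbody
  -- the token is genuine, since the key of the O-TEE is not disclosed
  rcases hσ with hσ | ⟨n, hn, hσ⟩
  · simp [Knowable, hsk] at hσ
  obtain rfl : sk = n := by simpa using hn
  rcases hσ with ⟨hσ, -⟩ | ⟨O', D', t, HS', z, hsk', hbody, hdh, htok⟩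
  · simp [hsk] at hσ
  simp only [hsk, Option.some.injEq, Role.oteeKey.injEq] at hsk'
  obtain ⟨rfl, rfl⟩ := hsk'
  simp only [signedPart, Msg.pair.injEq, Msg.gel.injEq, Msg.hash.injEq, Msg.kdf.injEq] at hbody
  obtain ⟨rfl, rfl, rfl⟩ := hbody
  -- `z = y ^ s` determines the exponent of the commitment that the O-TEE answered
  obtain ⟨f, hf, hf'⟩ := htok _ rfl
  obtain rfl : f = sc s := by simpa [add_comm f] using hf.symm
  rcases hf' with hf' | ⟨s', A', P', prop', HS', hss, hs', hread⟩
  · simp [disclosedExpo_sc.1 hf'] at hs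
  obtain rfl := sc_injective hss
  simp only [hs, Option.some.injEq, Role.aggrCommit.injEq] at hs'
  obtain ⟨rfl, rfl, rfl, rfl⟩ := hs'
  exact ⟨NP', D, HS, hreg, hread rfl, hagent, hkey, hdh⟩

/-! ### Executions -/

theorem AcceptJustified.mono {E E' : Set Event} (hE : E ⊆ E') {A O : Ident} {P prop : Msg} :
    AcceptJustified E A O P prop → AcceptJustified E' A O P prop := by
  rintro ⟨NP, D, DHE, h1, h2, h3, h4, h5⟩
  exact ⟨NP, D, DHE, hE h1, hE h2, hE h3, hE h4, hE h5⟩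

theorem Inv.init : Inv ⟨fun _ => none, ∅, ∅⟩ ⟨0, ∅⟩ := by
  constructor <;> simp [ownedNames]

theorem Exec.exists_inv {tr : List (List Event)} {c : Config} (h : Exec tr c) :
    ∃ g, Inv g c ∧ (∀ ev, ev ∈ g.events ↔ ∃ a ∈ tr, ev ∈ a) ∧
      ∀ A O P prop, AcceptedVerificationWithAgent A O P prop ∈ g.events →
        AcceptJustified g.events A O P prop := by
  induction h with
  | init => exact ⟨_, Inv.init, by simp, by simp⟩
  | step tr c c' a _ hstep ih =>
    obtain ⟨g, hinv, hev, hacc⟩ := ih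
    cases hstep with
    | new S used n hn => exact ⟨g, hinv.new hn, by simp [hev, or_and_right, exists_or], hacc⟩
    | adv S used l r h hp =>
      obtain ⟨ρ, hinv'⟩ := hinv.adv h hp
      have hE : (g.extend ρ ∅ []).events = g.events := by simp [Ghost.extend]
      refine ⟨_, hinv', ?_, ?_⟩
      · simp [hE, hev, or_and_right, exists_or]
      · rwa [hE]
    | proto S used l _ r h hp =>
      obtain ⟨ρ, sp, hinv'⟩ := hinv.proto h hp
      refine ⟨_, hinv', ?_, fun A O P prop h' => ?_⟩
      · simp [Ghost.extend, hev, or_and_right, exists_or]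
      · exact (h'.elim (hacc A O P prop) (hinv.acceptJustified h hp)).mono Set.subset_union_left

theorem exists_occursAt {tr : List (List Event)} {ev : Event} :
    (∃ i, OccursAt tr ev i) ↔ ∃ a ∈ tr, ev ∈ a := by
  simp only [OccursAt, List.mem_iff_getElem?]
  exact ⟨fun ⟨i, a, h, h'⟩ => ⟨a, ⟨i, h⟩, h'⟩, fun ⟨a, ⟨i, h⟩, h'⟩ => ⟨i, a, h, h'⟩⟩

end ODT

theorem mainTheorem4 (tr : List (List ODT.Event)) (htr : ODT.IsTrace tr)
    (AGR OTEE : ODT.Ident) (AGT prop : ODT.Msg) (i : ℕ)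
    (hacc : ODT.OccursAt tr (.AcceptedVerificationWithAgent AGR OTEE AGT prop) i) :
    ∃ (NP D : ODT.Ident) (DHE : ODT.Msg) (j k l m n : ℕ),
      ODT.OccursAt tr (.OTEERegisteredOnDevice NP OTEE D) j ∧
      ODT.OccursAt tr (.OTEEHonestPropertyRead OTEE D AGT prop) k ∧
      ODT.OccursAt tr (.AggressorCreateAgent AGR AGT prop) l ∧
      ODT.OccursAt tr (.AggrDHKey AGR DHE) m ∧
      ODT.OccursAt tr (.OTEEDHKey OTEE DHE) n := by
  obtain ⟨c, hc⟩ := htr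
  obtain ⟨g, -, hev, hjust⟩ := hc.exists_inv
  have occurs : ∀ {ev}, ev ∈ g.events → ∃ i, ODT.OccursAt tr ev i := fun h =>
    ODT.exists_occursAt.2 ((hev _).1 h)
  obtain ⟨NP, D, DHE, h1, h2, h3, h4, h5⟩ :=
    hjust _ _ _ _ ((hev _).2 (ODT.exists_occursAt.1 ⟨i, hacc⟩))
  obtain ⟨j, hj⟩ := occurs h1
  obtain ⟨k, hk⟩ := occurs h2
  obtain ⟨l, hl⟩ := occurs h3
  obtain ⟨m, hm⟩ := occurs h4
  obtain ⟨n, hn⟩ := occurs h5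
  exact ⟨NP, D, DHE, j, k, l, m, n, hj, hk, hl, hm, hn⟩
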